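/- Let $\alpha>0$ and let $\nu$ be a finite Borel measure (for instance, a probability measure) on the unit sphere $S^{d-1}\subset\mathbb{R}^d$ that is carried by finitely many distinct points $e^{(1)},\dots,e^{(l)}\in S^{d-1}$, with $\nu_i=\nu(\{e^{(i)}\})>0$ for $i=1,\dots,l$, and assume that the convex cone generated by $e^{(1)},\dots,e^{(l)}$ is all of $\mathbb{R}^d$. Let $\pi_{\alpha,\nu}$ be a Poisson point process in $\mathbb{R}^d$ whose intensity measure $\mu$ is concentrated on $\mathbb{R}^d\setminus\{0\}$ and is given in polar coordinates by $\mu=\theta\times\nu$, that is, $\mu\{x : |x|\in B,\ x/|x|\in E\}=\nu(E)\int_B \alpha r^{-\alpha-1}\,dr$ for Borel sets $B\subset(0,\infty)$ and $E\subset S^{d-1}$. Let $\varsigma_1$ be the random set of points of $\pi_{\alpha,\nu}$, and for $k\ge 1$ let $C_k(\pi_{\alpha,\nu})$ be the convex hull of $\varsigma_k$ and $\varsigma_{k+1}=\varsigma_k\setminus \mathrm{ext}\, C_k(\pi_{\alpha,\nu})$, where $\mathrm{ext}\,C$ denotes the set of extreme points of $C$. Let $C_\infty=C(A)$ be the convex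 hull of the set $A=\{\nu_1^{1/\alpha}e^{(1)},\dots,\nu_l^{1/\alpha}e^{(l)}\}$. Then, almost surely, as $k\to\infty$, $$d_H\bigl(k^{1/\alpha}\,C_k(\pi_{\alpha,\nu}),\;C_\infty\bigr)\to 0,$$ where $d_H$ is the Hausdorff distance. -/

import Mathlib

open MeasureTheory ProbabilityTheory Filter Topology
open scoped ENNReal NNReal Pointwise

/-- The Poisson distribution with mean `m ∈ [0, ∞]` on `{0, 1, 2, …, ∞}`; for `m = ∞` it is the
point mass at `∞`. -/
noncomputable def poissonLaw (m : ℝ≥0∞) : Measure ℕ∞ :=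
  if m = ∞ then Measure.dirac ⊤
  else (poissonMeasure m.toNNReal).map (fun n : ℕ => (n : ℕ∞))

/-- A random set `ς` of points of `E`, defined on the probability space `(Ω, P)`, is a Poisson point
process with intensity measure `μ` if it is countable, the number of its points in each Borel set `B`
is a random variable that has the Poisson distribution with mean `μ B`, and the numbers of its
points in pairwise disjoint Borel sets are independent. -/
structure IsPoissonPointProcess {Ω E : Type*} [MeasurableSpace Ω] [MeasurableSpace E]
    (P : Measure Ω) (μ : Measure E) (ς : Ω → Set E) : Prop where
  countable : ∀ ω, (ς ω).Countable
  measurable_count : ∀ B : Set E, MeasurableSet B → Measurable fun ω => (ς ω ∩ B).encard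
  hasLaw_count : ∀ B : Set E, MeasurableSet B →
    HasLaw (fun ω => (ς ω ∩ B).encard) (poissonLaw (μ B)) P
  indep_count : ∀ (n : ℕ) (B : Fin n → Set E), (∀ i, MeasurableSet (B i)) →
    Pairwise (fun i j => Disjoint (B i) (B j)) →
    iIndepFun (fun i ω => (ς ω ∩ B i).encard) P

/-- The radial measure `θ` on `(0, ∞)`, with density `α r ^ (-α - 1)`. -/
noncomputable def radialMeasure (α : ℝ) : Measure ℝ :=
  (volume.restrict (Set.Ioi 0)).withDensity fun r => ENNReal.ofReal (α * r ^ (-α - 1))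

/-- The measure `θ × ν` in polar coordinates, as a measure on `ℝ^d`: the image of the product under
`(r, e) ↦ r e`. -/
noncomputable def controlMeasure {d : ℕ} (α : ℝ)
    (ν : Measure (Metric.sphere (0 : EuclideanSpace ℝ (Fin d)) 1)) :
    Measure (EuclideanSpace ℝ (Fin d)) :=
  ((radialMeasure α).prod ν).map fun p => p.1 • (p.2 : EuclideanSpace ℝ (Fin d))

/-- The points of `s` that are left after `n` peelings, each of which removes the extreme points of
the convex hull of the points still present. -/
def peelPoints {E : Type*} [AddCommGroup E] [Module ℝ E] (s : Set E) : ℕ → Set E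
  | 0 => s
  | n + 1 => peelPoints s n \ (convexHull ℝ (peelPoints s n)).extremePoints ℝ

/-- The `k`-th convex hull `C_k` of the peeling of `s`, for `k ≥ 1`; in particular `C_1` is the convex
hull of `s`. (The value at `k = 0` is immaterial.) -/
def peelHull {E : Type*} [AddCommGroup E] [Module ℝ E] (s : Set E) (k : ℕ) : Set E :=
  convexHull ℝ (peelPoints s (k - 1))

/-!
On each of the rays spanned by `e i` the points of the process form a decreasing sequence of radii
`r i 0 > r i 1 > …`. In the coordinate `t = r ^ (-α)` this is a homogeneous Poisson process on
`(0, ∞)` with rate `ν {e i}`, so the strong law of large numbers gives, almost surely,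
`r i n ∼ a i * n ^ (-1 / α)` with `a i = ν {e i} ^ (1 / α)` (`IsPoissonPointProcess.ae_exists_radii`).
The rest is deterministic (`tendsto_hausdorffEDist_peelHull_rayPoints`).

Only the outermost remaining point of a ray can be extreme, so a peeling removes at most one point
from each ray. Hence the `k`-th hull contains the `k`-th point of every ray, and these are close to
the points `k ^ (-1 / α) * a i • e i` that span the rescaled limit shape `C`. This is the lower bound.

For the upper bound it must be shown that the rays do not lag behind, although the points `a i • e i`
need not be extreme in `C`. They are pushed outwards, within `(1 + ε) • C`, to points `b i • e i` in
strictly convex position, namely onto a level set of the gauge of `C` plus a small multiple of the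
squared norm (`exists_strictly_convex_radii`). If `h i` points of the ray `i` have been removed, let
`q i = (b i / r i (h i)) ^ α`, which is asymptotic to `c i * h i` with `c i = (b i / a i) ^ α > 1`.
By strict convexity there is a factor `θ > 1` such that the outermost point of the ray `i` is extreme
whenever `q i` is less than `θ` times every `q j`. So a ray is skipped only if it is ahead of the
slowest one by a fixed factor, and it follows that all `q i` grow at least at unit speed
(`eventually_sub_le_of_greedy_increments`). After `k` peelings all remaining points then lie in
about `k ^ (-1 / α) * (1 + ε) • C` (`exists_forall_mul_le_of_mem_peelPoints`).
-/

/-! ### Growth of counters -/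

/-- Counters `h k i` only grow, and at each step the counter whose value `q i (h k i)` is minimal grows.
Then all values eventually exceed any given bound: otherwise some counter with a value below the
bound would grow at every step, but there are only finitely many indices with such values. -/
theorem exists_all_lt_of_greedy_increments {ι : Type*} [Fintype ι] [Nonempty ι]
    {q : ι → ℕ → ℝ} (hqtop : ∀ i, Tendsto (q i) atTop atTop)
    {h : ℕ → ι → ℕ} (hmono : ∀ k i, h k i ≤ h (k + 1) i)
    (hmin : ∀ k i, (∀ j, q i (h k i) ≤ q j (h k j)) → h k i < h (k + 1) i) (M : ℝ) :
    ∃ k, ∀ i, M < q i (h k i) := by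
  by_contra! hcon
  -- no index beyond `J i` has a value at most `M`
  have hJ : ∀ i, ∃ J : ℕ, ∀ n, J ≤ n → M < q i n := fun i =>
    eventually_atTop.1 ((hqtop i).eventually_gt_atTop M)
  choose J hJ using hJ
  have hF : ∀ k, k ≤ ∑ i, min (h k i) (J i) := by
    intro k
    induction k with
    | zero => simp
    | succ k ih =>
      obtain ⟨i, -, hi⟩ := Finset.exists_min_image Finset.univ (fun i => q i (h k i))
        Finset.univ_nonempty
      have h1 := hmin k i fun j => hi j (Finset.mem_univ j)
      have h2 : h k i < J i := by
        by_contra! h3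
        obtain ⟨j, hj⟩ := hcon k
        exact absurd ((hJ i _ h3).trans_le (hi j (Finset.mem_univ j))) (not_lt.2 hj)
      refine Nat.succ_le_of_lt (ih.trans_lt
        (Finset.sum_lt_sum (fun j _ => ?_) ⟨i, Finset.mem_univ i, ?_⟩))
      · have := hmono k j; omega
      · omega
  have h1 := hF (∑ i, J i + 1)
  have h2 : ∑ i, min (h (∑ i, J i + 1) i) (J i) ≤ ∑ i, J i :=
    Finset.sum_le_sum fun i _ => min_le_right _ _
  omega

/-- The growth estimate behind the upper bound for the hulls. Each value sequence `q i` is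
asymptotically linear with slope `c i > 1`, and a counter `h k i` may pause at a step only when its
value exceeds some other one by the factor `θ > 1`. Then every value grows at least at unit speed:
a counter that moves gains the slope, and one that pauses is ahead by a margin which no single step
uses up. -/
theorem eventually_sub_le_of_greedy_increments {ι : Type*} [Fintype ι] [Nonempty ι]
    {q : ι → ℕ → ℝ} (hqpos : ∀ i n, 0 < q i n)
    {c : ι → ℝ} (hc : ∀ i, 1 < c i)
    (hqc : ∀ i, Tendsto (fun n : ℕ => q i n / ((n : ℝ) + 1)) atTop (𝓝 (c i)))
    {θ : ℝ} (hθ : 1 < θ) {h : ℕ → ι → ℕ}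
    (hmono : ∀ k i, h k i ≤ h (k + 1) i)
    (hskip : ∀ k i, h (k + 1) i = h k i → ∃ j, θ * q j (h k j) ≤ q i (h k i)) :
    ∃ K : ℕ, ∀ k, K ≤ k → ∀ i, (k : ℝ) - K ≤ q i (h k i) := by
  have hqtop : ∀ i, Tendsto (q i) atTop atTop := by
    intro i
    have h1 : Tendsto (fun n : ℕ => (n : ℝ) + 1) atTop atTop :=
      tendsto_atTop_add_const_right _ _ tendsto_natCast_atTop_atTop
    refine ((hqc i).pos_mul_atTop (by linarith [hc i]) h1).congr fun n => ?_
    have : (n : ℝ) + 1 ≠ 0 := by positivity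
    field_simp
  set σ := Real.sqrt θ with hσ
  have hσ1 : 1 < σ := by rw [hσ]; exact Real.lt_sqrt_of_sq_lt (by simpa using hθ)
  have hσσ : σ * σ = θ := Real.mul_self_sqrt (by linarith)
  -- two-sided linear bounds whose ratio `σ` is smaller than `θ`
  have hA : ∀ i, ∃ A : ℝ, 1 ≤ A ∧ A < c i ∧ c i < σ * A := by
    intro i
    have hc0 : 0 < c i := by linarith [hc i]
    have h1 : c i / σ < c i := div_lt_self hc0 hσ1
    refine ⟨max 1 ((c i / σ + c i) / 2), le_max_left _ _, max_lt (hc i) (by linarith), ?_⟩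
    have h2 : c i / σ < max 1 ((c i / σ + c i) / 2) := lt_max_of_lt_right (by linarith)
    have h3 : c i = σ * (c i / σ) := by field_simp
    calc c i = σ * (c i / σ) := h3
      _ < _ := by gcongr
  choose A hA1 hAc hcA using hA
  have hN : ∃ N : ℕ, ∀ n, N ≤ n → ∀ i,
      A i * ((n : ℝ) + 1) ≤ q i n ∧ q i n ≤ σ * A i * ((n : ℝ) + 1) := by
    refine eventually_atTop.1 (eventually_all.2 fun i => ?_)
    filter_upwards [(hqc i).eventually_const_lt (hAc i), (hqc i).eventually_lt_const (hcA i)]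
      with n h1 h2
    have hn : (0 : ℝ) < (n : ℝ) + 1 := by positivity
    exact ⟨((lt_div_iff₀ hn).1 h1).le, ((div_lt_iff₀ hn).1 h2).le⟩
  obtain ⟨N, hN⟩ := hN
  -- an index of minimal value is never skipped
  have hmin : ∀ k i, (∀ j, q i (h k i) ≤ q j (h k j)) → h k i < h (k + 1) i := by
    intro k i hi
    refine lt_of_le_of_ne (hmono k i) fun heq => ?_
    obtain ⟨j, hj⟩ := hskip k i heq.symm
    nlinarith [hi j, hqpos j (h k j)]
  obtain ⟨L, hL⟩ := exists_nat_ge (max (N : ℝ) (1 / (σ - 1)))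
  have hNL : N ≤ L := by exact_mod_cast (le_max_left _ _).trans hL
  have hσL : 1 / (σ - 1) ≤ L := (le_max_right _ _).trans hL
  -- from some step on, all indices exceed `L`
  obtain ⟨M, hM⟩ : ∃ M : ℝ, ∀ i, ∀ n ∈ Finset.range L, q i n ≤ M := by
    refine ⟨∑ i, ∑ n ∈ Finset.range L, q i n, fun i n hn => ?_⟩
    exact (Finset.single_le_sum (f := fun n => q i n) (fun n _ => (hqpos i n).le) hn).trans
      (Finset.single_le_sum (f := fun i => ∑ n ∈ Finset.range L, q i n)
        (fun i _ => Finset.sum_nonneg fun n _ => (hqpos i n).le) (Finset.mem_univ i))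
  obtain ⟨K, hK⟩ := exists_all_lt_of_greedy_increments hqtop hmono hmin M
  have hKL : ∀ i, L ≤ h K i := by
    intro i
    by_contra! hlt
    exact absurd (hK i) (not_lt.2 (hM i _ (Finset.mem_range.2 hlt)))
  have hinv : ∀ m : ℕ, ∀ i, L ≤ h (K + m) i ∧ (m : ℝ) + L ≤ A i * ((h (K + m) i : ℝ) + 1) := by
    intro m
    induction m with
    | zero =>
      intro i
      have h1 : (L : ℝ) ≤ h K i := by exact_mod_cast hKL i
      refine ⟨hKL i, ?_⟩
      simp only [Nat.cast_zero, zero_add, add_zero]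
      nlinarith [hA1 i]
    | succ m ih =>
      intro i
      refine ⟨(ih i).1.trans (hmono _ i), ?_⟩
      rcases (hmono (K + m) i).lt_or_eq with hlt | heq
      · have h1 : ((h (K + m) i : ℝ) + 1) ≤ h (K + (m + 1)) i := by exact_mod_cast hlt
        have h2 := (ih i).2
        push_cast
        nlinarith [hA1 i]
      · obtain ⟨j, hj⟩ := hskip (K + m) i heq.symm
        have h1 := (hN _ (hNL.trans (ih i).1) i).2
        have h2 := (hN _ (hNL.trans (ih j).1) j).1
        have h3 := (ih j).2
        rw [show K + (m + 1) = K + m + 1 by ring, ← heq]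
        -- the skipped index is ahead of the minimum by the factor `θ / σ = σ`
        have h4 : σ * ((m : ℝ) + L) ≤ A i * ((h (K + m) i : ℝ) + 1) := by
          have h5 : σ * (σ * ((m : ℝ) + L)) ≤ σ * (A i * ((h (K + m) i : ℝ) + 1)) := by
            calc σ * (σ * ((m : ℝ) + L)) = θ * ((m : ℝ) + L) := by rw [← hσσ]; ring
              _ ≤ θ * q j (h (K + m) j) := by gcongr; linarith
              _ ≤ σ * A i * ((h (K + m) i : ℝ) + 1) := hj.trans h1
              _ = _ := by ring
          exact le_of_mul_le_mul_left h5 (by linarith)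
        have h6 : 1 ≤ (σ - 1) * L := by
          rwa [div_le_iff₀ (by linarith), mul_comm] at hσL
        push_cast
        nlinarith [Nat.cast_nonneg (α := ℝ) m]
  refine ⟨K, fun k hk i => ?_⟩
  obtain ⟨m, rfl⟩ := Nat.exists_eq_add_of_le hk
  have h1 := hinv m i
  have h2 := (hN _ (hNL.trans h1.1) i).1
  push_cast
  linarith [h1.2, Nat.cast_nonneg (α := ℝ) L]

/-! ### Extreme points and absorbing hulls -/

/-- A point at which a linear functional attains a strict maximum over `S` is an extreme point of the
convex hull of `S`. -/
theorem mem_extremePoints_convexHull_of_forall_lt {E : Type*} [AddCommGroup E] [Module ℝ E]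
    {S : Set E} {x : E} (hx : x ∈ S) (f : E →ₗ[ℝ] ℝ) (hf : ∀ y ∈ S, y ≠ x → f y < f x) :
    x ∈ (convexHull ℝ S).extremePoints ℝ := by
  have hconv : Convex ℝ ({y | f y < f x} ∪ {x}) := by
    rw [convex_iff_forall_pos]
    intro y hy z hz s t hs ht hst
    have hle : ∀ w ∈ {y | f y < f x} ∪ {x}, f w ≤ f x := by
      rintro w (hw | rfl)
      exacts [le_of_lt hw, le_rfl]
    have hfs : f (s • y + t • z) = s * f y + t * f z := by simp
    have hfx : f x = s * f x + t * f x := by rw [← add_mul, hst, one_mul]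
    rcases hy with hy | rfl
    · left
      change f _ < f x
      have := hle z hz
      rw [hfs, hfx]
      have : f y < f x := hy
      nlinarith
    · rcases hz with hz | rfl
      · left
        change f _ < f y
        have : f z < f y := hz
        rw [hfs, hfx]
        nlinarith
      · right
        simp [← add_smul, hst]
  have hsub : convexHull ℝ S ⊆ {y | f y < f x} ∪ {x} := by
    refine convexHull_min (fun y hy => ?_) hconv
    by_cases h : y = x
    · exact Or.inr h
    · exact Or.inl (hf y hy h)
  rw [mem_extremePoints_iff_left]
  refine ⟨subset_convexHull ℝ S hx, fun y hy z hz hxyz => ?_⟩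
  obtain ⟨s, t, hs, ht, hst, hxeq⟩ := hxyz
  rcases hsub hy with hy' | hy'
  · exfalso
    have h1 : f z ≤ f x := by
      rcases hsub hz with h | h
      exacts [le_of_lt h, by rw [show z = x from h]]
    have h2 : f y < f x := hy'
    have h3 : f x = s * f y + t * f z := by rw [← hxeq]; simp
    have h4 : f x = s * f x + t * f x := by rw [← add_mul, hst, one_mul]
    nlinarith
  · exact hy'

/-- If the cone generated by the directions `e i` is the whole space, then the convex hull of any
positive multiples of them is absorbent; in particular it contains `0`. -/
theorem absorbent_convexHull_of_hull_eq_top {ι E : Type*} [Nonempty ι] [AddCommGroup E]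
    [Module ℝ E] {e : ι → E} (hcone : PointedCone.hull ℝ (Set.range e) = ⊤) {a : ι → ℝ}
    (ha : ∀ i, 0 < a i) : Absorbent ℝ (convexHull ℝ (Set.range fun i => a i • e i)) := by
  set C := convexHull ℝ (Set.range fun i => a i • e i) with hC
  have hCconv : Convex ℝ C := convex_convexHull _ _
  have hmem : ∀ i, a i • e i ∈ C := fun i => subset_convexHull ℝ _ ⟨i, rfl⟩
  obtain ⟨i₀⟩ := ‹Nonempty ι›
  have hP : ∀ x : E, ∃ r : ℝ, 0 ≤ r ∧ x ∈ r • C := by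
    intro x
    have hx : x ∈ PointedCone.hull ℝ (Set.range e) := hcone ▸ Submodule.mem_top
    induction hx using Submodule.span_induction with
    | mem x hx =>
      obtain ⟨i, rfl⟩ := hx
      exact ⟨(a i)⁻¹, (inv_pos.2 (ha i)).le, a i • e i, hmem i, by
        simp [smul_smul, inv_mul_cancel₀ (ha i).ne']⟩
    | zero => exact ⟨0, le_rfl, a i₀ • e i₀, hmem i₀, by simp⟩
    | add x y _ _ hx hy =>
      obtain ⟨r, hr, hx⟩ := hx
      obtain ⟨s, hs, hy⟩ := hy
      exact ⟨r + s, add_nonneg hr hs, by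
        rw [hCconv.add_smul hr hs]; exact Set.add_mem_add hx hy⟩
    | smul c x _ hx =>
      obtain ⟨r, hr, y, hy, rfl⟩ := hx
      exact ⟨c * r, mul_nonneg c.2 hr, y, hy, by
        simp only [mul_smul]; rfl⟩
  have h0 : (0 : E) ∈ C := by
    obtain ⟨r, hr, hx⟩ := hP (-(a i₀ • e i₀))
    have h1 : (0 : E) ∈ (1 + r) • C := by
      rw [hCconv.add_smul zero_le_one hr, one_smul]
      exact ⟨_, hmem i₀, _, hx, by simp⟩
    obtain ⟨y, hy, hy0⟩ := h1
    have : y = 0 := (smul_eq_zero.1 hy0).resolve_left (by positivity)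
    rwa [← this]
  have hP' : ∀ x : E, ∃ r : ℝ, 0 ≤ r ∧ ∀ t, r ≤ t → x ∈ t • C := by
    intro x
    obtain ⟨r, hr, hx⟩ := hP x
    refine ⟨r, hr, fun t ht => ?_⟩
    have : t • C = r • C + (t - r) • C := by
      rw [← hCconv.add_smul hr (by linarith)]; congr 1; ring
    rw [this]
    exact ⟨x, hx, 0, ⟨0, h0, by simp⟩, by simp⟩
  intro x
  obtain ⟨r, hr, hx⟩ := hP' x
  obtain ⟨s, hs, hy⟩ := hP' (-x)
  refine Absorbs.of_norm ⟨max r s, fun c hc => ?_⟩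
  rw [Set.singleton_subset_iff]
  rw [Real.norm_eq_abs] at hc
  rcases le_total 0 c with h | h
  · rw [abs_of_nonneg h] at hc
    exact hx c ((le_max_left _ _).trans hc)
  · rw [abs_of_nonpos h] at hc
    obtain ⟨y, hy, hyx⟩ := hy (-c) ((le_max_right _ _).trans hc)
    exact ⟨y, hy, by simpa using hyx⟩

/-! ### Pushing the vertices into strictly convex position -/

/-- Distinct nonzero points on a level set of the strictly convex function `g + η ‖·‖²` are in convex
position, even together with the origin. -/
theorem notMem_convexHull_of_forall_eq {ι E : Type*} [NormedAddCommGroup E]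
    [InnerProductSpace ℝ E] {g : E → ℝ} (hg : ConvexOn ℝ Set.univ g) {η M : ℝ} (hη : 0 < η)
    (hg0 : g 0 ≤ M) {p : ι → E} (hinj : Function.Injective p) (hp0 : ∀ i, p i ≠ 0)
    (hp : ∀ i, g (p i) + η * ‖p i‖ ^ 2 = M) (i : ι) :
    p i ∉ convexHull ℝ (insert 0 (p '' {j | j ≠ i})) := by
  have hN : StrictConvexOn ℝ Set.univ fun x => g x + η * ‖x‖ ^ 2 := by
    refine hg.add_strictConvexOn ⟨convex_univ, fun x _ y _ hxy s t hs ht hst => ?_⟩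
    have h1 : s * ‖x‖ ^ 2 + t * ‖y‖ ^ 2 - ‖s • x + t • y‖ ^ 2 = s * t * ‖x - y‖ ^ 2 := by
      rw [norm_add_sq_real, norm_sub_sq_real, norm_smul, norm_smul, inner_smul_left,
        inner_smul_right, Real.norm_of_nonneg hs.le, Real.norm_of_nonneg ht.le]
      obtain rfl : t = 1 - s := by linarith
      simp
      ring
    have h2 : 0 < ‖x - y‖ := norm_pos_iff.2 (sub_ne_zero.2 hxy)
    have h3 : 0 < s * t * ‖x - y‖ ^ 2 := by positivity
    simp only [smul_eq_mul]
    nlinarith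
  set K : Set E := {x | g x + η * ‖x‖ ^ 2 ≤ M} with hK
  have hKconv : Convex ℝ K := by
    simpa [hK] using hN.convexOn.convex_le M
  have hext : p i ∈ K.extremePoints ℝ := by
    rw [mem_extremePoints]
    refine ⟨(hp i).le, fun x hx y hy hxy => ?_⟩
    by_cases hne : x = y
    · subst hne
      rw [openSegment_same] at hxy
      exact ⟨hxy.symm, hxy.symm⟩
    · exfalso
      obtain ⟨s, t, hs, ht, hst, hxy⟩ := hxy
      have h1 := hN.2 (Set.mem_univ x) (Set.mem_univ y) hne hs ht hst
      simp only [hxy, hp, smul_eq_mul] at h1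
      have hx' : g x + η * ‖x‖ ^ 2 ≤ M := hx
      have hy' : g y + η * ‖y‖ ^ 2 ≤ M := hy
      have : M = s * M + t * M := by rw [← add_mul, hst, one_mul]
      nlinarith
  have hdiff := (hKconv.mem_extremePoints_iff_convex_sdiff.1 hext).2
  intro hmem
  refine (convexHull_min (t := K \ {p i}) ?_ hdiff hmem).2 rfl
  rintro x (rfl | ⟨j, hj, rfl⟩)
  · exact ⟨by simpa [hK] using hg0, (hp0 i).symm⟩
  · exact ⟨(hp j).le, fun h => hj (hinj h)⟩

/-- The points `a i • e i` can be pushed outwards along their rays, without leaving `1 + ε` times their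
convex hull, to points `b i • e i` each of which a linear functional separates from all the others,
with a uniform margin. Some of the points `a i • e i` may fail to be extreme, and may then move far. -/
theorem exists_strictly_convex_radii {ι E : Type*} [Finite ι] [Nonempty ι] [NormedAddCommGroup E]
    [InnerProductSpace ℝ E] {e : ι → E} (he0 : ∀ i, e i ≠ 0)
    (hray : ∀ i j (s t : ℝ), 0 < s → 0 < t → s • e i = t • e j → i = j ∧ s = t)
    (hcone : PointedCone.hull ℝ (Set.range e) = ⊤) {a : ι → ℝ}
    (ha : ∀ i, 0 < a i) {ε : ℝ} (hε : 0 < ε) :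
    ∃ b : ι → ℝ, (∀ i, a i < b i) ∧
      (∀ i, b i • e i ∈ (1 + ε) • convexHull ℝ (Set.range fun i => a i • e i)) ∧
      ∃ θ : ℝ, 1 < θ ∧ ∃ f : ι → E →ₗ[ℝ] ℝ, (∀ i, f i (b i • e i) = 1) ∧
        ∀ i j, j ≠ i → f i (b j • e j) ≤ θ⁻¹ := by
  have := Fintype.ofFinite ι
  have habs := absorbent_convexHull_of_hull_eq_top hcone ha
  set C := convexHull ℝ (Set.range fun i => a i • e i) with hC
  have hCconv : Convex ℝ C := convex_convexHull _ _
  have hCmem : ∀ i, a i • e i ∈ C := fun i => subset_convexHull ℝ _ ⟨i, rfl⟩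
  have hgauge : ConvexOn ℝ Set.univ (gauge C) := by
    refine ⟨convex_univ, fun x _ y _ s t hs ht hst => ?_⟩
    refine (gauge_add_le hCconv habs _ _).trans ?_
    rw [gauge_smul_of_nonneg hs, gauge_smul_of_nonneg ht]
  obtain ⟨η, hη, hηa⟩ : ∃ η : ℝ, 0 < η ∧ ∀ i, η * ‖a i • e i‖ ^ 2 < ε / 2 := by
    set S := ∑ i, ‖a i • e i‖ ^ 2
    have hS : ∀ i, ‖a i • e i‖ ^ 2 ≤ S := fun i =>
      Finset.single_le_sum (f := fun i => ‖a i • e i‖ ^ 2) (fun i _ => by positivity)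
        (Finset.mem_univ i)
    have hS0 : 0 ≤ S := Finset.sum_nonneg fun i _ => by positivity
    refine ⟨ε / 2 / (S + 1), by positivity, fun i => ?_⟩
    rw [div_mul_eq_mul_div, div_lt_iff₀ (by positivity)]
    have := hS i
    nlinarith
  -- `b i` is where the ray leaves the strictly convex level set at height `1 + ε / 2`
  have hb : ∀ i, ∃ b, a i < b ∧ gauge C (b • e i) + η * ‖b • e i‖ ^ 2 = 1 + ε / 2 := by
    intro i
    set φ : ℝ → ℝ := fun b => b * gauge C (e i) + η * (b ^ 2 * ‖e i‖ ^ 2) with hφ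
    have hφeq : ∀ b, 0 ≤ b → gauge C (b • e i) + η * ‖b • e i‖ ^ 2 = φ b := by
      intro b hb
      rw [gauge_smul_of_nonneg hb, norm_smul, mul_pow, Real.norm_of_nonneg hb, smul_eq_mul]
    have h1 : φ (a i) < 1 + ε / 2 := by
      rw [← hφeq _ (ha i).le]
      linarith [gauge_le_one_of_mem (hCmem i), hηa i]
    have hn : 0 < ‖e i‖ ^ 2 := by have := norm_pos_iff.2 (he0 i); positivity
    obtain ⟨B, hB, hB1, hB2⟩ : ∃ B : ℝ, 1 + ε / 2 ≤ φ B ∧ a i ≤ B ∧ 1 ≤ B := by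
      refine ⟨max (max (a i) 1) ((1 + ε / 2) / (η * ‖e i‖ ^ 2)), ?_,
        (le_max_left _ _).trans (le_max_left _ _), (le_max_right _ _).trans (le_max_left _ _)⟩
      set B := max (max (a i) 1) ((1 + ε / 2) / (η * ‖e i‖ ^ 2))
      have hB1 : 1 ≤ B := (le_max_right _ _).trans (le_max_left _ _)
      have h2 : 1 + ε / 2 ≤ B * (η * ‖e i‖ ^ 2) :=
        (div_le_iff₀ (by positivity)).1 (le_max_right _ _)
      have h3 : 0 ≤ B * gauge C (e i) := mul_nonneg (by linarith) (gauge_nonneg _)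
      have h4 : B * (η * ‖e i‖ ^ 2) ≤ B ^ 2 * (η * ‖e i‖ ^ 2) := by
        gcongr
        nlinarith
      simp only [hφ]
      nlinarith
    have hcont : ContinuousOn φ (Set.Icc (a i) B) := by
      simp only [hφ]; fun_prop
    obtain ⟨b, ⟨hb1, -⟩, hb⟩ := intermediate_value_Icc hB1 hcont ⟨h1.le, hB⟩
    refine ⟨b, lt_of_le_of_ne hb1 ?_, by rw [hφeq b ((ha i).le.trans hb1), hb]⟩
    rintro rfl
    exact h1.ne hb
  choose b hab hb using hb
  have hb0 : ∀ i, 0 < b i := fun i => (ha i).trans (hab i)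
  have hp0 : ∀ i, b i • e i ≠ 0 := fun i => smul_ne_zero (hb0 i).ne' (he0 i)
  have hinj : Function.Injective fun i => b i • e i := fun i j hij =>
    (hray i j _ _ (hb0 i) (hb0 j) hij).1
  have hf : ∀ i, ∃ f : E →ₗ[ℝ] ℝ, f (b i • e i) = 1 ∧ ∀ j, j ≠ i → f (b j • e j) < 1 := by
    intro i
    have hnot := notMem_convexHull_of_forall_eq hgauge hη
      (by rw [gauge_zero]; positivity) hinj hp0 hb i
    obtain ⟨f, u, hf1, hf2⟩ := geometric_hahn_banach_closed_point (convex_convexHull ℝ _)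
      (((Set.toFinite ((fun i => b i • e i) '' {j | j ≠ i})).insert 0).isClosed_convexHull ℝ) hnot
    have hu : 0 < u := by
      simpa using hf1 0 (subset_convexHull ℝ _ (Set.mem_insert _ _))
    have hpos : 0 < f (b i • e i) := hu.trans hf2
    refine ⟨(f (b i • e i))⁻¹ • f.toLinearMap, ?_, fun j hj => ?_⟩
    · exact inv_mul_cancel₀ hpos.ne'
    · have h1 : f (b j • e j) < u :=
        hf1 _ (subset_convexHull ℝ _ (Set.mem_insert_of_mem _ ⟨j, hj, rfl⟩))
      change (f (b i • e i))⁻¹ * f (b j • e j) < 1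
      rw [inv_mul_lt_iff₀ hpos]
      linarith
  choose f hf1 hf2 using hf
  -- finitely many strict inequalities leave a uniform margin
  obtain ⟨τ, hτ0, hτ1, hτ⟩ : ∃ τ : ℝ, 0 < τ ∧ τ < 1 ∧ ∀ i j, j ≠ i → f i (b j • e j) ≤ τ := by
    have h1 : ∀ᶠ τ in 𝓝[<] (1 : ℝ), ∀ i j, j ≠ i → f i (b j • e j) ≤ τ := by
      refine eventually_all.2 fun i => eventually_all.2 fun j => ?_
      by_cases hj : j = i
      · exact Eventually.of_forall fun τ h => absurd hj h
      · filter_upwards [eventually_nhdsWithin_of_eventually_nhds (lt_mem_nhds (hf2 i j hj))]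
          with τ hτ _ using hτ.le
    obtain ⟨τ, ⟨h2, h3⟩, h4⟩ := ((h1.and (eventually_nhdsWithin_of_eventually_nhds
      (lt_mem_nhds (zero_lt_one' ℝ)))).and self_mem_nhdsWithin).exists
    exact ⟨τ, h3, h4, h2⟩
  refine ⟨b, hab, fun i => ?_, τ⁻¹, (one_lt_inv₀ hτ0).2 hτ1, f, hf1, by simpa using hτ⟩
  have h1 : gauge C (b i • e i) < 1 + ε := by
    have : 0 ≤ η * ‖b i • e i‖ ^ 2 := by positivity
    linarith [hb i]
  rw [Set.mem_smul_set_iff_inv_smul_mem₀ (by positivity)]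
  refine setOfPred_gauge_lt_one_subset_self hCconv ?_ habs ?_
  · exact habs.zero_mem
  · change gauge C _ < 1
    rw [gauge_smul_of_nonneg (by positivity), smul_eq_mul, inv_mul_lt_iff₀ (by positivity)]
    linarith

/-! ### Peeling a set of points on finitely many rays -/

/-- The points `r i n • e i` with `n ≥ h i`: along each direction `e i`, the points at the radii
`r i 0, r i 1, …` without the first `h i` of them. -/
def rayPoints {ι E : Type*} [SMul ℝ E] (e : ι → E) (r : ι → ℕ → ℝ) (h : ι → ℕ) : Set E :=
  {x | ∃ i n, h i ≤ n ∧ r i n • e i = x}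

/-- On each ray only the outermost remaining point can be extreme: any other one lies strictly between
the outermost point and a point further inside. -/
theorem notMem_extremePoints_rayPoints {ι E : Type*} [AddCommGroup E] [Module ℝ E]
    {e : ι → E} (he0 : ∀ i, e i ≠ 0) {r : ι → ℕ → ℝ} (hr : ∀ i, StrictAnti (r i))
    {h : ι → ℕ} {i : ι} {n : ℕ} (hn : h i < n) :
    r i n • e i ∉ (convexHull ℝ (rayPoints e r h)).extremePoints ℝ := by
  intro hx
  have h1 : r i (n + 1) < r i n := hr i (Nat.lt_succ_self n)
  have h2 : r i n < r i (h i) := hr i hn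
  have hseg : r i n • e i ∈ openSegment ℝ (r i (n + 1) • e i) (r i (h i) • e i) := by
    have h3 : r i n ∈ openSegment ℝ (r i (n + 1)) (r i (h i)) := by
      rw [openSegment_eq_Ioo (h1.trans h2)]; exact ⟨h1, h2⟩
    obtain ⟨s, t, hs, ht, hst, heq⟩ := h3
    refine ⟨s, t, hs, ht, hst, ?_⟩
    rw [← heq, add_smul, smul_eq_mul, smul_eq_mul, mul_smul, mul_smul]
  have h4 := (mem_extremePoints.1 hx).2 _ (subset_convexHull ℝ _ ⟨i, n + 1, by omega, rfl⟩) _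
    (subset_convexHull ℝ _ ⟨i, h i, le_rfl, rfl⟩) hseg
  exact h1.ne (smul_left_injective ℝ (he0 i) h4.1)

open Classical in
/-- The dynamics of the peeling: after `k` peelings the first `h k i` points of the ray `i` are gone,
where a counter moves by at most one at each step, and moves if the outermost point of its ray is
extreme. -/
theorem exists_peelPoints_eq_rayPoints {ι E : Type*} [AddCommGroup E] [Module ℝ E]
    {e : ι → E} (he0 : ∀ i, e i ≠ 0)
    {r : ι → ℕ → ℝ} (hr : ∀ i, StrictAnti (r i)) :
    ∃ h : ℕ → ι → ℕ, (∀ k, peelPoints (rayPoints e r 0) k = rayPoints e r (h k)) ∧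
      (∀ k i, h k i ≤ k) ∧ (∀ k i, h k i ≤ h (k + 1) i) ∧
      ∀ k i, h (k + 1) i = h k i →
        r i (h k i) • e i ∉ (convexHull ℝ (rayPoints e r (h k))).extremePoints ℝ := by
  set step : (ι → ℕ) → ι → ℕ := fun h i =>
    if r i (h i) • e i ∈ (convexHull ℝ (rayPoints e r h)).extremePoints ℝ then h i + 1 else h i
    with hstep
  have hstep_le : ∀ h i, step h i ≤ h i + 1 := fun h i => by
    simp only [hstep]; split_ifs <;> omega
  have hle_step : ∀ h i, h i ≤ step h i := fun h i => by
    simp only [hstep]; split_ifs <;> omega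
  have hpeel : ∀ h, rayPoints e r h \ (convexHull ℝ (rayPoints e r h)).extremePoints ℝ =
      rayPoints e r (step h) := by
    intro h
    ext x
    constructor
    · rintro ⟨⟨i, n, hn, rfl⟩, hx⟩
      refine ⟨i, n, ?_, rfl⟩
      rcases hn.lt_or_eq with hlt | rfl
      · exact (hstep_le h i).trans hlt
      · simp only [hstep, if_neg hx, le_refl]
    · rintro ⟨i, n, hn, rfl⟩
      refine ⟨⟨i, n, (hle_step h i).trans hn, rfl⟩, ?_⟩
      rcases ((hle_step h i).trans hn).lt_or_eq with hlt | rfl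
      · exact notMem_extremePoints_rayPoints he0 hr hlt
      · intro hx
        simp only [hstep, if_pos hx] at hn
        omega
  refine ⟨fun k => step^[k] 0, fun k => ?_, fun k i => ?_, fun k i => ?_, fun k i hk hx => ?_⟩
  · induction k with
    | zero => rfl
    | succ k ih =>
      simp only [peelPoints, ih, hpeel, Function.iterate_succ_apply']
  · induction k with
    | zero => simp
    | succ k ih =>
      simp only [Function.iterate_succ_apply']
      exact (hstep_le _ _).trans (Nat.succ_le_succ ih)
  · simp only [Function.iterate_succ_apply']
    exact hle_step _ _
  · simp only [Function.iterate_succ_apply'] at hk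
    simp only [hstep] at hk hx
    rw [if_pos hx] at hk
    omega

/-- If, in units of the radii `b`, the outermost point on the ray `i` is within the factor `θ` of the
outermost points on the other rays, then it is extreme. -/
theorem mem_extremePoints_rayPoints {ι E : Type*} [AddCommGroup E] [Module ℝ E]
    {e : ι → E} {r : ι → ℕ → ℝ} (hr0 : ∀ i n, 0 < r i n) (hr : ∀ i, StrictAnti (r i))
    {b : ι → ℝ} (hb : ∀ i, 0 < b i) {θ : ℝ} (hθ : 0 < θ) {i : ι} {f : E →ₗ[ℝ] ℝ}
    (hf1 : f (b i • e i) = 1) (hf2 : ∀ j, j ≠ i → f (b j • e j) ≤ θ⁻¹) {h : ι → ℕ}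
    (hmax : ∀ j, b i / r i (h i) < θ * (b j / r j (h j))) :
    r i (h i) • e i ∈ (convexHull ℝ (rayPoints e r h)).extremePoints ℝ := by
  have hval : ∀ j n, f (r j n • e j) = r j n / b j * f (b j • e j) := by
    intro j n
    have := (hb j).ne'
    rw [map_smul, map_smul, smul_eq_mul, smul_eq_mul]
    field_simp
  refine mem_extremePoints_convexHull_of_forall_lt ⟨i, h i, le_rfl, rfl⟩ f ?_
  rintro _ ⟨j, n, hn, rfl⟩ hne
  rw [hval i, hf1, mul_one]
  have hrj : r j n ≤ r j (h j) := (hr j).antitone hn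
  by_cases hj : j = i
  · subst hj
    rw [hval, hf1, mul_one]
    refine div_lt_div_of_pos_right ?_ (hb j)
    rcases hn.lt_or_eq with hlt | rfl
    · exact hr j hlt
    · exact absurd rfl hne
  · have h1 : r j (h j) / b j * θ⁻¹ < r i (h i) / b i := by
      have h2 := inv_strictAnti₀ (div_pos (hb i) (hr0 i (h i))) (hmax j)
      rw [mul_inv, inv_div, inv_div] at h2
      linarith
    rw [hval]
    have hbj := hb j
    have hr0j := hr0 j n
    calc r j n / b j * f (b j • e j) ≤ r j n / b j * θ⁻¹ := by gcongr; exact hf2 j hj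
      _ ≤ r j (h j) / b j * θ⁻¹ := by gcongr
      _ < _ := h1

/-- The upper bound: up to a shift of `k` by a constant, the points left after `k` peelings lie in
`k ^ (-1 / α) * (1 + ε)` times the limit shape. -/
theorem exists_forall_mul_le_of_mem_peelPoints {ι E : Type*} [Fintype ι] [Nonempty ι]
    [NormedAddCommGroup E] [InnerProductSpace ℝ E] {e : ι → E} (he0 : ∀ i, e i ≠ 0)
    (hray : ∀ i j (s t : ℝ), 0 < s → 0 < t → s • e i = t • e j → i = j ∧ s = t)
    (hcone : PointedCone.hull ℝ (Set.range e) = ⊤) {α : ℝ} (hα : 0 < α) {a : ι → ℝ}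
    (ha : ∀ i, 0 < a i) {r : ι → ℕ → ℝ} (hr0 : ∀ i n, 0 < r i n) (hr : ∀ i, StrictAnti (r i))
    (hra : ∀ i, Tendsto (fun n : ℕ => ((n : ℝ) + 1) ^ (1 / α) * r i n) atTop (𝓝 (a i)))
    {ε : ℝ} (hε : 0 < ε) :
    ∃ K : ℕ, ∀ k, K < k → ∀ x ∈ peelPoints (rayPoints e r 0) k,
      ((k : ℝ) - K) ^ (1 / α) • x ∈ (1 + ε) • convexHull ℝ (Set.range fun i => a i • e i) := by
  obtain ⟨b, hab, hbC, θ, hθ, f, hf1, hf2⟩ := exists_strictly_convex_radii he0 hray hcone ha hε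
  obtain ⟨h, hpeel, -, hmono, hskip⟩ := exists_peelPoints_eq_rayPoints he0 hr
  have h0C := (absorbent_convexHull_of_hull_eq_top hcone ha).zero_mem
  set C := convexHull ℝ (Set.range fun i => a i • e i)
  have hCconv : Convex ℝ C := convex_convexHull _ _
  have hb : ∀ i, 0 < b i := fun i => (ha i).trans (hab i)
  have hbr : ∀ i n, 0 < b i / r i n := fun i n => div_pos (hb i) (hr0 i n)
  obtain ⟨K, hK⟩ := eventually_sub_le_of_greedy_increments
    (q := fun i n => (b i / r i n) ^ α) (c := fun i => (b i / a i) ^ α) (θ := θ ^ α) (h := h)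
    (fun i n => Real.rpow_pos_of_pos (hbr i n) α)
    (fun i => Real.one_lt_rpow ((one_lt_div (ha i)).2 (hab i)) hα)
    (fun i => by
      have h1 := ((tendsto_const_nhds (x := b i)).div (hra i) (ha i).ne').rpow_const
        (p := α) (Or.inr hα.le)
      refine h1.congr fun n => ?_
      have hn : (0 : ℝ) < (n : ℝ) + 1 := by positivity
      have hrn := hr0 i n
      have hbi := hb i
      rw [Pi.div_apply, mul_comm, ← div_div, Real.div_rpow (by positivity) (by positivity),
        ← Real.rpow_mul hn.le, one_div_mul_cancel hα.ne', Real.rpow_one])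
    (Real.one_lt_rpow hθ hα) hmono
    (fun k i hki => by
      by_contra! hcon
      refine hskip k i hki (mem_extremePoints_rayPoints hr0 hr hb (by linarith) (hf1 i) (hf2 i)
        fun j => ?_)
      have h1 := hcon j
      rw [← Real.mul_rpow (by linarith) (hbr _ _).le] at h1
      exact (Real.rpow_lt_rpow_iff (hbr _ _).le
        (mul_nonneg (by linarith) (hbr _ _).le) hα).1 h1)
  refine ⟨K, fun k hk x hx => ?_⟩
  rw [hpeel] at hx
  obtain ⟨i, n, hn, rfl⟩ := hx
  have hkK : (0 : ℝ) < (k : ℝ) - K := sub_pos.2 (by exact_mod_cast hk)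
  set s := ((k : ℝ) - K) ^ (1 / α) with hs
  have hs0 : 0 < s := Real.rpow_pos_of_pos hkK _
  have h1 : s ≤ b i / r i n := by
    have h2 := Real.rpow_le_rpow hkK.le (hK k hk.le i) (one_div_pos.2 hα).le
    rw [← Real.rpow_mul (hbr _ _).le, mul_one_div_cancel hα.ne', Real.rpow_one] at h2
    refine h2.trans ?_
    have := hr0 i n
    have := hb i
    gcongr
    exact (hr i).antitone hn
  have h2 : s • r i n • e i = (s * r i n / b i) • b i • e i := by
    rw [smul_smul, smul_smul]
    congr 1
    field_simp [(hb i).ne']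
  rw [h2]
  have h3 : s * r i n / b i ≤ 1 := by
    rw [div_le_one (hb i)]
    exact (le_div_iff₀ (hr0 i n)).1 h1
  have h4 : 0 ≤ s * r i n / b i := by have := hr0 i n; have := hb i; positivity
  exact (hCconv.smul (1 + ε)).smul_mem_of_zero_mem ⟨0, h0C, smul_zero _⟩ (hbC i) ⟨h4, h3⟩

/-- The deterministic limit theorem: if the `n`-th radius on the ray `i` is asymptotic to
`a i * n ^ (-1 / α)`, then the rescaled hulls of the peeling converge to the convex hull of the
points `a i • e i`. -/
theorem tendsto_hausdorffEDist_peelHull_rayPoints {ι E : Type*} [Fintype ι] [Nonempty ι]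
    [NormedAddCommGroup E] [InnerProductSpace ℝ E] {e : ι → E} (he0 : ∀ i, e i ≠ 0)
    (hray : ∀ i j (s t : ℝ), 0 < s → 0 < t → s • e i = t • e j → i = j ∧ s = t)
    (hcone : PointedCone.hull ℝ (Set.range e) = ⊤) {α : ℝ} (hα : 0 < α) {a : ι → ℝ}
    (ha : ∀ i, 0 < a i) {r : ι → ℕ → ℝ} (hr0 : ∀ i n, 0 < r i n) (hr : ∀ i, StrictAnti (r i))
    (hra : ∀ i, Tendsto (fun n : ℕ => ((n : ℝ) + 1) ^ (1 / α) * r i n) atTop (𝓝 (a i))) :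
    Tendsto (fun k : ℕ => Metric.hausdorffEDist
        ((k : ℝ) ^ (1 / α) • peelHull (rayPoints e r 0) k)
        (convexHull ℝ (Set.range fun i => a i • e i))) atTop (𝓝 0) := by
  have h0C := (absorbent_convexHull_of_hull_eq_top hcone ha).zero_mem
  set C := convexHull ℝ (Set.range fun i => a i • e i) with hC
  have hCconv : Convex ℝ C := convex_convexHull _ _
  obtain ⟨R, hR0, hR⟩ : ∃ R : ℝ, 0 < R ∧ ∀ x ∈ C, ‖x‖ ≤ R := by
    have hbdd : Bornology.IsBounded C :=
      isBounded_convexHull.2 (Set.finite_range _).isBounded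
    exact hbdd.exists_pos_norm_le
  obtain ⟨h, hpeel, hle, -, -⟩ := exists_peelPoints_eq_rayPoints he0 hr
  -- it suffices to bound the distances by each real `ε > 0`, along the shifted sequence
  suffices hmain : ∀ ε : ℝ, 0 < ε → ∀ᶠ m : ℕ in atTop, Metric.hausdorffEDist
      (((m + 1 : ℕ) : ℝ) ^ (1 / α) • peelHull (rayPoints e r 0) (m + 1)) C ≤ ENNReal.ofReal ε by
    rw [← tendsto_add_atTop_iff_nat 1, ENNReal.tendsto_nhds_zero]
    intro ε hε
    obtain ⟨δ, hδ0, hδ⟩ := ENNReal.lt_iff_exists_nnreal_btwn.1 hε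
    filter_upwards [hmain δ (by exact_mod_cast hδ0)] with m hm
    exact hm.trans (by simpa using hδ.le)
  intro ε hε
  obtain ⟨δ, hδ0, hδ1, hδ⟩ : ∃ δ : ℝ, 0 < δ ∧ δ ≤ 1 ∧ 3 * δ * R < ε := by
    refine ⟨min 1 (ε / (4 * R)), by positivity, min_le_left _ _, ?_⟩
    have h1 : min 1 (ε / (4 * R)) ≤ ε / (4 * R) := min_le_right _ _
    calc 3 * min 1 (ε / (4 * R)) * R ≤ 3 * (ε / (4 * R)) * R := by gcongr
      _ = 3 / 4 * ε := by field_simp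
      _ < ε := by linarith
  obtain ⟨K, hK⟩ := exists_forall_mul_le_of_mem_peelPoints he0 hray hcone hα ha hr0 hr hra hδ0
  have hratio : ∀ᶠ m : ℕ in atTop, (((m + 1 : ℕ) : ℝ) / ((m : ℝ) - K)) ^ (1 / α) < 1 + δ := by
    have h1 : Tendsto (fun m : ℕ => ((m + 1 : ℕ) : ℝ) / ((m : ℝ) - K)) atTop (𝓝 1) := by
      have h2 : Tendsto (fun m : ℕ => (m : ℝ) - K) atTop atTop :=
        tendsto_atTop_add_const_right _ _ tendsto_natCast_atTop_atTop
      have h3 := (h2.const_div_atTop ((K : ℝ) + 1)).const_add 1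
      rw [add_zero] at h3
      refine h3.congr' ?_
      filter_upwards [eventually_gt_atTop K] with m hm
      have : (m : ℝ) - K ≠ 0 := (sub_pos.2 (by exact_mod_cast hm)).ne'
      push_cast
      field_simp
      ring
    have h4 := h1.rpow_const (p := 1 / α) (Or.inr (one_div_pos.2 hα).le)
    rw [Real.one_rpow] at h4
    exact h4.eventually_lt_const (by linarith)
  have hnear : ∀ᶠ m : ℕ in atTop, ∀ i,
      dist (((m : ℝ) + 1) ^ (1 / α) * r i m) (a i) * ‖e i‖ < ε := by
    refine eventually_all.2 fun i => ?_
    have h1 : Tendsto (fun m : ℕ => dist (((m : ℝ) + 1) ^ (1 / α) * r i m) (a i) * ‖e i‖)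
        atTop (𝓝 0) := by
      simpa using ((tendsto_iff_dist_tendsto_zero.1 (hra i)).mul_const ‖e i‖)
    exact h1.eventually_lt_const hε
  filter_upwards [hratio, hnear, eventually_gt_atTop K] with m hm1 hm2 hmK
  have hmK' : (0 : ℝ) < (m : ℝ) - K := sub_pos.2 (by exact_mod_cast hmK)
  have hPH : peelHull (rayPoints e r 0) (m + 1) =
      convexHull ℝ (peelPoints (rayPoints e r 0) m) := rfl
  rw [hPH, ← convexHull_smul]
  set s := ((m + 1 : ℕ) : ℝ) ^ (1 / α) with hs
  have hupper : convexHull ℝ (s • peelPoints (rayPoints e r 0) m) ⊆ Metric.thickening ε C := by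
    refine convexHull_min ?_ (hCconv.thickening ε)
    rintro _ ⟨x, hx, rfl⟩
    obtain ⟨c, hc, hcx⟩ := hK m hmK x hx
    set u := ((m : ℝ) - K) ^ (1 / α) with hu
    have hu0 : 0 < u := Real.rpow_pos_of_pos hmK' _
    rw [Real.div_rpow (by positivity) hmK'.le, ← hs, ← hu] at hm1
    set t := s / u * (1 + δ) with ht
    have hsx : s • x = t • c := by
      simp only at hcx
      rw [ht, mul_smul, hcx, smul_smul, div_mul_cancel₀ _ hu0.ne']
    have ht0 : 0 ≤ t := by positivity
    have ht1 : t ≤ (1 + δ) * (1 + δ) := by rw [ht]; gcongr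
    rw [Metric.mem_thickening_iff]
    refine ⟨min t 1 • c, hCconv.smul_mem_of_zero_mem h0C hc ⟨by positivity, min_le_right _ _⟩, ?_⟩
    change dist (s • x) _ < ε
    have hmin : |t - min t 1| ≤ 3 * δ := by
      rw [abs_of_nonneg (sub_nonneg.2 (min_le_left _ _))]
      rcases le_total t 1 with h1 | h1
      · rw [min_eq_left h1]; linarith
      · rw [min_eq_right h1]; nlinarith
    rw [hsx, dist_eq_norm, ← sub_smul, norm_smul, Real.norm_eq_abs]
    calc |t - min t 1| * ‖c‖ ≤ 3 * δ * R := by gcongr; exact hR c hc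
      _ < ε := hδ
  have hlower : C ⊆ Metric.thickening ε (convexHull ℝ (s • peelPoints (rayPoints e r 0) m)) := by
    refine convexHull_min ?_ ((convex_convexHull ℝ _).thickening ε)
    rintro _ ⟨i, rfl⟩
    rw [Metric.mem_thickening_iff]
    refine ⟨s • r i m • e i, subset_convexHull ℝ _ (Set.smul_mem_smul_set ?_), ?_⟩
    · rw [hpeel]; exact ⟨i, m, hle m i, rfl⟩
    · have h1 := hm2 i
      rw [smul_smul, dist_comm, dist_eq_norm, ← sub_smul, norm_smul, ← dist_eq_norm, hs]
      push_cast
      exact h1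
  refine Metric.hausdorffEDist_le_of_infEDist (fun x hx => ?_) fun x hx => ?_
  · exact (show Metric.infEDist x C < ENNReal.ofReal ε from hupper hx).le
  · exact (show Metric.infEDist x _ < ENNReal.ofReal ε from hlower hx).le

/-! ### Enumerating a set of reals with given counts -/

/-- An infinite set of reals with finitely many elements below each bound is the range of a strictly
increasing sequence. -/
theorem Set.Infinite.exists_strictMono_range_eq {Q : Set ℝ} (hQ : Q.Infinite)
    (hfin : ∀ M, (Q ∩ Set.Iic M).Finite) : ∃ q : ℕ → ℝ, StrictMono q ∧ Set.range q = Q := by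
  obtain ⟨x₀, hx₀⟩ := hQ.nonempty
  obtain ⟨m, ⟨hmQ, -⟩, hm⟩ := Set.exists_min_image (Q ∩ Set.Iic x₀) id (hfin x₀)
    ⟨x₀, hx₀, Set.self_mem_Iic⟩
  have hmin : ∀ x ∈ Q, m ≤ x := by
    intro x hx
    rcases le_total x x₀ with h | h
    · exact hm x ⟨hx, h⟩
    · exact (hm x₀ ⟨hx₀, Set.self_mem_Iic⟩).trans h
  let _ : LocallyFiniteOrder Q := LocallyFiniteOrder.ofFiniteIcc fun x y =>
    ((hfin y).preimage Subtype.val_injective.injOn).subset fun z hz => ⟨z.2, hz.2⟩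
  let _ : OrderBot Q := { bot := ⟨m, hmQ⟩, bot_le := fun x => hmin x x.2 }
  let _ : NoMaxOrder Q := ⟨fun x => by
    by_contra! h
    exact hQ ((hfin x).subset fun y hy => ⟨hy, h ⟨y, hy⟩⟩)⟩
  let _ : SuccOrder Q := LinearLocallyFiniteOrder.succOrder Q
  let _ : PredOrder Q := LinearLocallyFiniteOrder.predOrder Q
  refine ⟨fun n => (orderIsoNatOfLinearSuccPredArch (ι := Q)).symm n, fun a b hab =>
    (orderIsoNatOfLinearSuccPredArch (ι := Q)).symm.strictMono hab, ?_⟩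
  rw [show (fun n => ((orderIsoNatOfLinearSuccPredArch (ι := Q)).symm n : ℝ)) =
    Subtype.val ∘ (orderIsoNatOfLinearSuccPredArch (ι := Q)).symm from rfl, Set.range_comp,
    (orderIsoNatOfLinearSuccPredArch (ι := Q)).symm.surjective.range_eq]
  simp

theorem StrictMono.lt_ncard_range_inter_Iio_iff {q : ℕ → ℝ} (hq : StrictMono q) {M : ℝ}
    (hfin : (Set.range q ∩ Set.Iio M).Finite) (n : ℕ) :
    n < (Set.range q ∩ Set.Iio M).ncard ↔ q n < M := by
  have hex : ∃ n, M ≤ q n := by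
    by_contra! h
    refine Set.infinite_range_of_injective hq.injective (hfin.subset ?_)
    rintro _ ⟨n, rfl⟩
    exact ⟨⟨n, rfl⟩, h n⟩
  classical
  have hiff : ∀ n, q n < M ↔ n < Nat.find hex := by
    intro n
    rw [Nat.lt_find_iff]
    refine ⟨fun h m hm => not_le.2 ((hq.monotone hm).trans_lt h), fun h => not_le.1 (h n le_rfl)⟩
  have himage : Set.range q ∩ Set.Iio M = q '' Set.Iio (Nat.find hex) := by
    ext x
    constructor
    · rintro ⟨⟨n, rfl⟩, hn⟩
      exact ⟨n, (hiff n).1 hn, rfl⟩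
    · rintro ⟨n, hn, rfl⟩
      exact ⟨⟨n, rfl⟩, (hiff n).2 hn⟩
  rw [himage, Set.ncard_image_of_injective _ hq.injective, hiff]
  simp

/-- Inversion of a counting function: if `q` has about `v * M` terms below `M`, then `q n` is asymptotic
to `n / v`. -/
theorem StrictMono.tendsto_succ_div_of_tendsto_ncard {q : ℕ → ℝ} (hq : StrictMono q)
    (hq0 : ∀ n, 0 < q n) (hfin : ∀ M, (Set.range q ∩ Set.Iio M).Finite) {v : ℝ}
    (hv : Tendsto (fun n : ℕ => ((Set.range q ∩ Set.Iio (n : ℝ)).ncard : ℝ) / n) atTop (𝓝 v)) :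
    Tendsto (fun n : ℕ => ((n : ℝ) + 1) / q n) atTop (𝓝 v) := by
  have hqtop : Tendsto q atTop atTop := by
    refine tendsto_atTop_atTop_of_monotone hq.monotone fun M => ?_
    by_contra! h
    refine Set.infinite_range_of_injective hq.injective ((hfin M).subset ?_)
    rintro _ ⟨n, rfl⟩
    exact ⟨⟨n, rfl⟩, h n⟩
  set N : ℕ → ℝ := fun n => ((Set.range q ∩ Set.Iio (n : ℝ)).ncard : ℝ) with hN
  set k : ℕ → ℕ := fun n => ⌊q n⌋₊ with hk
  have hktop : Tendsto k atTop atTop := tendsto_nat_floor_atTop.comp hqtop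
  have hkq : Tendsto (fun n => (k n : ℝ) / q n) atTop (𝓝 1) :=
    tendsto_nat_floor_div_atTop.comp hqtop
  have hkq' : Tendsto (fun n => ((k n + 1 : ℕ) : ℝ) / q n) atTop (𝓝 1) := by
    have h1 := hkq.add (hqtop.const_div_atTop 1)
    rw [add_zero] at h1
    exact h1.congr fun n => by push_cast; rw [add_div]
  have hlow : Tendsto (fun n => N (k n) / q n) atTop (𝓝 v) := by
    have h1 := (hv.comp hktop).mul hkq
    rw [mul_one] at h1
    refine h1.congr' ?_
    filter_upwards [hktop.eventually_gt_atTop 0] with n hn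
    have : (k n : ℝ) ≠ 0 := by exact_mod_cast hn.ne'
    simp only [Function.comp, hN]
    field_simp
  have hup : Tendsto (fun n => N (k n + 1) / q n) atTop (𝓝 v) := by
    have h1 := (hv.comp ((tendsto_add_atTop_nat 1).comp hktop)).mul hkq'
    rw [mul_one] at h1
    refine h1.congr fun n => ?_
    have : ((k n + 1 : ℕ) : ℝ) ≠ 0 := by positivity
    simp only [Function.comp, hN]
    field_simp
  refine tendsto_of_tendsto_of_tendsto_of_le_of_le hlow hup (fun n => ?_) fun n => ?_
  · have h1 : ¬ n < (Set.range q ∩ Set.Iio ((k n : ℕ) : ℝ)).ncard := by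
      rw [hq.lt_ncard_range_inter_Iio_iff (hfin _), not_lt]
      exact Nat.floor_le (hq0 n).le
    have h2 : N (k n) ≤ n := by simp only [hN]; exact_mod_cast not_lt.1 h1
    have := hq0 n
    change N (k n) / q n ≤ _
    gcongr
    linarith
  · have h1 : n < (Set.range q ∩ Set.Iio ((k n + 1 : ℕ) : ℝ)).ncard := by
      rw [hq.lt_ncard_range_inter_Iio_iff (hfin _)]
      push_cast
      exact Nat.lt_floor_add_one (q n)
    have h2 : (n : ℝ) + 1 ≤ N (k n + 1) := by simp only [hN]; exact_mod_cast h1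
    have := hq0 n
    change _ ≤ N (k n + 1) / q n
    gcongr

/-- If the numbers of elements of `Q` in the unit intervals `[j + 1, j + 2)` average to `v > 0`, then `Q`
is enumerated by an increasing sequence asymptotic to `n / v`. -/
theorem exists_strictMono_range_eq_of_tendsto_shell_average {Q : Set ℝ} (hQ0 : ∀ t ∈ Q, 0 < t)
    (hfin0 : (Q ∩ Set.Iio 1).Finite)
    (hfin : ∀ j : ℕ, (Q ∩ Set.Ico ((j : ℝ) + 1) (j + 2)).Finite) {v : ℝ} (hv : 0 < v)
    (hlim : Tendsto (fun n : ℕ => (∑ j ∈ Finset.range n,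
      ((Q ∩ Set.Ico ((j : ℝ) + 1) (j + 2)).ncard : ℝ)) / n) atTop (𝓝 v)) :
    ∃ q : ℕ → ℝ, StrictMono q ∧ Set.range q = Q ∧
      Tendsto (fun n : ℕ => ((n : ℝ) + 1) / q n) atTop (𝓝 v) := by
  have hsplit : ∀ n : ℕ, Q ∩ Set.Iio (((n + 1 : ℕ) : ℝ) + 1) =
      Q ∩ Set.Iio ((n : ℝ) + 1) ∪ Q ∩ Set.Ico ((n : ℝ) + 1) (n + 2) := by
    intro n
    rw [← Set.inter_union_distrib_left, Set.Iio_union_Ico_eq_Iio (by linarith)]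
    push_cast
    congr 2
    ring
  have hfinN : ∀ n : ℕ, (Q ∩ Set.Iio ((n : ℝ) + 1)).Finite := by
    intro n
    induction n with
    | zero => simpa using hfin0
    | succ n ih => rw [hsplit]; exact ih.union (hfin n)
  have hfinM : ∀ M, (Q ∩ Set.Iic M).Finite := by
    intro M
    obtain ⟨n, hn⟩ := exists_nat_ge M
    exact (hfinN n).subset fun x hx => ⟨hx.1, (hx.2.trans hn).trans_lt (lt_add_one _)⟩
  have hcard : ∀ n : ℕ, ((Q ∩ Set.Iio ((n : ℝ) + 1)).ncard : ℝ) = (Q ∩ Set.Iio 1).ncard +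
      ∑ j ∈ Finset.range n, ((Q ∩ Set.Ico ((j : ℝ) + 1) (j + 2)).ncard : ℝ) := by
    intro n
    induction n with
    | zero => simp
    | succ n ih =>
      rw [hsplit, Set.ncard_union_eq ?_ (hfinN n) (hfin n), Finset.sum_range_succ]
      · push_cast
        rw [ih]
        ring
      · rw [Set.disjoint_left]
        rintro x ⟨-, h1⟩ ⟨-, h2⟩
        exact absurd h2.1 (not_le.2 h1)
  have hlim' : Tendsto (fun n : ℕ => ((Q ∩ Set.Iio (n : ℝ)).ncard : ℝ) / n) atTop (𝓝 v) := by
    rw [← tendsto_add_atTop_iff_nat 1]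
    have h1 : Tendsto (fun n : ℕ => (n : ℝ) / ((n : ℝ) + 1)) atTop (𝓝 1) :=
      tendsto_natCast_div_add_atTop 1
    have h2 := ((tendsto_const_div_atTop_nhds_zero_nat ((Q ∩ Set.Iio 1).ncard : ℝ)).add
      hlim).mul h1
    rw [zero_add, mul_one] at h2
    refine h2.congr' ?_
    filter_upwards [eventually_gt_atTop 0] with n hn
    have : (n : ℝ) ≠ 0 := by exact_mod_cast hn.ne'
    have : (n : ℝ) + 1 ≠ 0 := by positivity
    push_cast
    rw [hcard]
    field_simp
  have hinf : Q.Infinite := by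
    intro hQ
    have h1 : Tendsto (fun n : ℕ => ((Q ∩ Set.Iio (n : ℝ)).ncard : ℝ) / n) atTop (𝓝 0) := by
      refine squeeze_zero (fun n => by positivity) (fun n => ?_)
        (tendsto_const_div_atTop_nhds_zero_nat (Q.ncard : ℝ))
      have := Set.ncard_le_ncard (Set.inter_subset_left : Q ∩ Set.Iio (n : ℝ) ⊆ Q) hQ
      gcongr
    exact hv.ne (tendsto_nhds_unique h1 hlim')
  obtain ⟨q, hq, rfl⟩ := hinf.exists_strictMono_range_eq hfinM
  exact ⟨q, hq, rfl, hq.tendsto_succ_div_of_tendsto_ncard (fun n => hQ0 _ ⟨n, rfl⟩)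
    (fun M => (hfinM M).subset (Set.inter_subset_inter_right _ Set.Iio_subset_Iic_self)) hlim'⟩

/-! ### The mean of the Poisson distribution -/

theorem poissonMeasure_id_hasSum (r : ℝ≥0) :
    HasSum (fun n : ℕ => Real.exp (-r) * r ^ n / (n.factorial : ℝ) * n) r := by
  rw [← hasSum_nat_add_iff' 1]
  have h := (hasSum_one_poissonMeasure r).mul_left (r : ℝ)
  simp only [Finset.range_one, Finset.sum_singleton, Nat.cast_zero, mul_zero, sub_zero]
  rw [mul_one] at h
  convert! h using 2 with n
  rw [Nat.factorial_succ]
  push_cast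
  have : (n.factorial : ℝ) ≠ 0 := by positivity
  field_simp
  ring

theorem integrable_natCast_poissonMeasure (r : ℝ≥0) :
    Integrable (fun n : ℕ => (n : ℝ)) (poissonMeasure r) := by
  rw [integrable_poissonMeasure_iff]
  simpa using (poissonMeasure_id_hasSum r).summable

theorem integral_natCast_poissonMeasure (r : ℝ≥0) :
    ∫ n : ℕ, (n : ℝ) ∂(poissonMeasure r) = r := by
  rw [integral_poissonMeasure]
  exact (poissonMeasure_id_hasSum r).tsum_eq

/-! ### Counts of a Poisson point process -/

section
variable {Ω E : Type*} [MeasurableSpace Ω] [MeasurableSpace E] {P : Measure Ω} {μ : Measure E}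
  {ς : Ω → Set E}

theorem IsPoissonPointProcess.ae_finite_inter (hς : IsPoissonPointProcess P μ ς) {B : Set E}
    (hB : MeasurableSet B) (hμ : μ B ≠ ∞) : ∀ᵐ ω ∂P, (ς ω ∩ B).Finite := by
  have h := (hς.hasLaw_count B hB).measure_eq (p := fun n => n = ⊤) .of_discrete
  rw [ae_iff]
  have h2 : {ω | ¬(ς ω ∩ B).Finite} = {ω | (ς ω ∩ B).encard = ⊤} := by
    ext ω
    exact Set.encard_eq_top_iff.symm
  rw [h2, h, poissonLaw, if_neg hμ, Measure.map_apply .of_discrete .of_discrete]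
  have h3 : (fun n : ℕ => (n : ℕ∞)) ⁻¹' {n | n = ⊤} = ∅ := by
    ext n; simp
  rw [h3, measure_empty]

theorem IsPoissonPointProcess.ae_inter_eq_empty (hς : IsPoissonPointProcess P μ ς) {B : Set E}
    (hB : MeasurableSet B) (hμ : μ B = 0) : ∀ᵐ ω ∂P, ς ω ∩ B = ∅ := by
  have h := (hς.hasLaw_count B hB).measure_eq (p := fun n => n ≠ 0) .of_discrete
  rw [ae_iff]
  have h2 : {ω | ¬(ς ω ∩ B) = ∅} = {ω | (ς ω ∩ B).encard ≠ 0} := by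
    ext ω
    simp
  rw [h2, h, poissonLaw, hμ, if_neg (by simp), Measure.map_apply .of_discrete .of_discrete]
  have h3 : ((fun n : ℕ => (n : ℕ∞)) ⁻¹' {n | n ≠ 0}) = {0}ᶜ := by
    ext n; simp
  rw [h3, prob_compl_eq_zero_iff (.of_discrete), poissonMeasure_singleton]
  simp

/-- The strong law of large numbers for the counts of a Poisson point process in disjoint sets of equal
intensity. -/
theorem IsPoissonPointProcess.ae_tendsto_average_ncard [IsProbabilityMeasure P]
    (hς : IsPoissonPointProcess P μ ς) {B : ℕ → Set E} (hB : ∀ n, MeasurableSet (B n))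
    (hdisj : Pairwise fun i j => Disjoint (B i) (B j)) {m : ℝ≥0∞} (hm : m ≠ ∞)
    (hμ : ∀ n, μ (B n) = m) :
    ∀ᵐ ω ∂P, Tendsto (fun n : ℕ => (∑ j ∈ Finset.range n, ((ς ω ∩ B j).ncard : ℝ)) / n)
      atTop (𝓝 m.toReal) := by
  have hlaw : ∀ n, HasLaw (fun ω => (ς ω ∩ B n).encard) (poissonLaw m) P := fun n => by
    rw [← hμ n]; exact hς.hasLaw_count _ (hB n)
  have hident : ∀ n, IdentDistrib (fun ω => ((ς ω ∩ B n).ncard : ℝ))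
      (fun ω => ((ς ω ∩ B 0).ncard : ℝ)) P P := fun n =>
    ((hlaw n).identDistrib (hlaw 0)).comp (u := fun k : ℕ∞ => (k.toNat : ℝ)) .of_discrete
  have hpoisson : IdentDistrib (fun ω => ((ς ω ∩ B 0).ncard : ℝ)) (fun n : ℕ => (n : ℝ))
      P (poissonMeasure m.toNNReal) := by
    have h1 : HasLaw (fun n : ℕ => (n : ℕ∞)) (poissonLaw m) (poissonMeasure m.toNNReal) :=
      ⟨Measurable.of_discrete.aemeasurable, by rw [poissonLaw, if_neg hm]⟩
    exact ((hlaw 0).identDistrib h1).comp (u := fun k : ℕ∞ => (k.toNat : ℝ)) .of_discrete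
  have hindep : Pairwise (Function.onFun (fun X Y => IndepFun X Y P)
      fun n ω => ((ς ω ∩ B n).ncard : ℝ)) := by
    intro i j hij
    have h1 := hς.indep_count 2 ![B i, B j] (fun k => by fin_cases k <;> simp [hB]) (by
      intro k l hkl
      fin_cases k <;> fin_cases l <;> simp_all [hdisj hij, (hdisj hij).symm])
    have h2 := h1.indepFun (i := 0) (j := 1) (by decide)
    exact h2.comp (φ := fun k : ℕ∞ => (k.toNat : ℝ)) (ψ := fun k : ℕ∞ => (k.toNat : ℝ))
      .of_discrete .of_discrete
  have h := strong_law_ae_real (fun n ω => ((ς ω ∩ B n).ncard : ℝ))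
    (hpoisson.integrable_iff.2 (integrable_natCast_poissonMeasure _)) hindep hident
  rw [hpoisson.integral_eq, integral_natCast_poissonMeasure] at h
  exact h
end

/-! ### The intensity measure on a ray -/

/-- The points `x ≠ 0` on the ray spanned by the unit vector `u` for which `|x| ^ (-α)` lies in
`T`. -/
def rayPiece {E : Type*} [NormedAddCommGroup E] [NormedSpace ℝ E] (α : ℝ) (u : E) (T : Set ℝ) :
    Set E :=
  {x | 0 < ‖x‖ ∧ ‖x‖ ^ (-α) ∈ T ∧ ‖x‖ • u = x}

theorem measurableSet_rayPiece {E : Type*} [NormedAddCommGroup E] [NormedSpace ℝ E]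
    [MeasurableSpace E] [BorelSpace E] [SecondCountableTopology E] (α : ℝ) (u : E) {T : Set ℝ}
    (hT : MeasurableSet T) : MeasurableSet (rayPiece α u T) := by
  refine (measurableSet_lt measurable_const measurable_norm).inter (MeasurableSet.inter ?_ ?_)
  · exact (measurable_norm.pow_const (-α)) hT
  · exact measurableSet_eq_fun (measurable_norm.smul_const u) measurable_id

theorem radialMeasure_Ioi {α : ℝ} (hα : 0 < α) {s : ℝ} (hs : 0 < s) :
    radialMeasure α (Set.Ioi s) = ENNReal.ofReal (s ^ (-α)) := by
  have hint : IntegrableOn (fun r : ℝ => α * r ^ (-α - 1)) (Set.Ioi s) :=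
    (integrableOn_Ioi_rpow_of_lt (by linarith) hs).const_mul α
  rw [radialMeasure, withDensity_apply _ measurableSet_Ioi,
    Measure.restrict_restrict measurableSet_Ioi,
    Set.inter_eq_left.2 (Set.Ioi_subset_Ioi hs.le), ← ofReal_integral_eq_lintegral_ofReal hint]
  · congr 1
    rw [integral_const_mul, integral_Ioi_rpow_of_lt (by linarith) hs]
    rw [sub_add_cancel]
    field_simp
  · filter_upwards [ae_restrict_mem measurableSet_Ioi] with r hr
    have : 0 < r := hs.trans hr
    positivity

theorem radialMeasure_Iic_zero (α : ℝ) : radialMeasure α (Set.Iic 0) = 0 := by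
  rw [radialMeasure, withDensity_apply _ measurableSet_Iic,
    Measure.restrict_restrict measurableSet_Iic, Set.Iic_inter_Ioi, Set.Ioc_self,
    Measure.restrict_empty, lintegral_zero_measure]

/-- The image of `radialMeasure α` under `r ↦ r ^ (-α)` is Lebesgue measure on `(0, ∞)`, tested on the
intervals `(0, c)`. -/
theorem radialMeasure_rpow_neg_Iio {α : ℝ} (hα : 0 < α) {c : ℝ} (hc : 0 < c) :
    radialMeasure α {r | 0 < r ∧ r ^ (-α) ∈ Set.Iio c} = ENNReal.ofReal c := by
  have h1 : {r : ℝ | 0 < r ∧ r ^ (-α) ∈ Set.Iio c} = Set.Ioi (c ^ (-α)⁻¹) := by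
    ext r
    constructor
    · rintro ⟨hr, hrc⟩
      exact (Real.rpow_inv_lt_iff_of_neg hc hr (by linarith)).2 hrc
    · intro hr
      have hr0 : 0 < r := (Real.rpow_pos_of_pos hc _).trans hr
      exact ⟨hr0, (Real.rpow_inv_lt_iff_of_neg hc hr0 (by linarith)).1 hr⟩
  rw [h1, radialMeasure_Ioi hα (Real.rpow_pos_of_pos hc _), ← Real.rpow_mul hc.le,
    inv_mul_cancel₀ (by linarith), Real.rpow_one]

theorem radialMeasure_rpow_neg_Ico {α : ℝ} (hα : 0 < α) {c d : ℝ} (hc : 0 < c) (hcd : c ≤ d) :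
    radialMeasure α {r | 0 < r ∧ r ^ (-α) ∈ Set.Ico c d} = ENNReal.ofReal (d - c) := by
  have h1 : {r : ℝ | 0 < r ∧ r ^ (-α) ∈ Set.Ico c d} =
      {r | 0 < r ∧ r ^ (-α) ∈ Set.Iio d} \ {r | 0 < r ∧ r ^ (-α) ∈ Set.Iio c} := by
    ext r
    simp only [Set.mem_ofPred_eq, Set.mem_Ico, Set.mem_Iio, Set.mem_sdiff]
    grind
  have hmeas : MeasurableSet {r : ℝ | 0 < r ∧ r ^ (-α) ∈ Set.Iio c} :=
    measurableSet_Ioi.inter ((measurable_id.pow_const (-α)) measurableSet_Iio)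
  rw [h1, measure_sdiff _ hmeas.nullMeasurableSet, radialMeasure_rpow_neg_Iio hα hc,
    radialMeasure_rpow_neg_Iio hα (hc.trans_le hcd), ENNReal.ofReal_sub _ hc.le]
  · rw [radialMeasure_rpow_neg_Iio hα hc]; exact ENNReal.ofReal_ne_top
  · rintro r ⟨hr, hrc⟩
    exact ⟨hr, lt_of_lt_of_le hrc hcd⟩

section
variable {d : ℕ} {α : ℝ} {ν : Measure (Metric.sphere (0 : EuclideanSpace ℝ (Fin d)) 1)}

theorem measurable_polar : Measurable fun p : ℝ × Metric.sphere (0 : EuclideanSpace ℝ (Fin d)) 1 =>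
    p.1 • (p.2 : EuclideanSpace ℝ (Fin d)) := by
  fun_prop

theorem radialMeasure_prod_nonpos [SFinite ν] :
    ((radialMeasure α).prod ν) {p | p.1 ≤ 0} = 0 := by
  rw [show {p : ℝ × Metric.sphere (0 : EuclideanSpace ℝ (Fin d)) 1 | p.1 ≤ 0} =
    Set.Iic 0 ×ˢ Set.univ by ext; simp, Measure.prod_prod, radialMeasure_Iic_zero, zero_mul]

theorem controlMeasure_rayPiece [SFinite ν]
    (u : Metric.sphere (0 : EuclideanSpace ℝ (Fin d)) 1) {T : Set ℝ} (hT : MeasurableSet T) :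
    controlMeasure α ν (rayPiece α (u : EuclideanSpace ℝ (Fin d)) T) =
      radialMeasure α {r | 0 < r ∧ r ^ (-α) ∈ T} * ν {u} := by
  rw [controlMeasure, Measure.map_apply measurable_polar (measurableSet_rayPiece _ _ hT),
    ← Measure.prod_prod]
  refine measure_congr ?_
  have h0 : ∀ᵐ p ∂(radialMeasure α).prod ν, ¬ p.1 ≤ 0 := by
    rw [ae_iff]; simpa using radialMeasure_prod_nonpos
  filter_upwards [h0] with p hp
  have hp : 0 < p.1 := not_le.1 hp
  have hnorm : ‖p.1 • (p.2 : EuclideanSpace ℝ (Fin d))‖ = p.1 := by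
    rw [norm_smul, Real.norm_of_nonneg hp.le, norm_eq_of_mem_sphere, mul_one]
  refine propext ?_
  change (0 < ‖p.1 • (p.2 : EuclideanSpace ℝ (Fin d))‖ ∧
    ‖p.1 • (p.2 : EuclideanSpace ℝ (Fin d))‖ ^ (-α) ∈ T ∧
    ‖p.1 • (p.2 : EuclideanSpace ℝ (Fin d))‖ • (u : EuclideanSpace ℝ (Fin d)) =
      p.1 • (p.2 : EuclideanSpace ℝ (Fin d))) ↔ (0 < p.1 ∧ p.1 ^ (-α) ∈ T) ∧ p.2 = u
  rw [hnorm, and_assoc]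
  refine and_congr_right fun _ => and_congr_right fun _ => ?_
  rw [smul_right_inj hp.ne', Subtype.coe_inj, eq_comm]

theorem controlMeasure_compl_rays [SFinite ν] {ι : Type*} [Countable ι]
    {e : ι → Metric.sphere (0 : EuclideanSpace ℝ (Fin d)) 1} (hsupp : ν (Set.range e)ᶜ = 0) :
    controlMeasure α ν (⋃ i, rayPiece α (e i : EuclideanSpace ℝ (Fin d)) Set.univ)ᶜ = 0 := by
  rw [controlMeasure, Measure.map_apply measurable_polar
    (MeasurableSet.iUnion fun i => measurableSet_rayPiece _ _ MeasurableSet.univ).compl]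
  have h1 : ((radialMeasure α).prod ν) (Set.univ ×ˢ (Set.range e)ᶜ) = 0 := by
    rw [Measure.prod_prod, hsupp, mul_zero]
  refine measure_mono_null ?_ (measure_union_null radialMeasure_prod_nonpos h1)
  rintro ⟨r, x⟩ hx
  by_contra hcon
  simp only [Set.mem_union, Set.mem_ofPred_eq, Set.mem_prod, Set.mem_univ, true_and,
    Set.mem_compl_iff, Set.mem_range, not_or, not_not, not_le] at hcon
  obtain ⟨hr, i, rfl⟩ := hcon
  refine hx (Set.mem_iUnion.2 ⟨i, ?_⟩)
  have hnorm : ‖r • (e i : EuclideanSpace ℝ (Fin d))‖ = r := by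
    rw [norm_smul, Real.norm_of_nonneg hr.le, norm_eq_of_mem_sphere, mul_one]
  change 0 < ‖r • (e i : EuclideanSpace ℝ (Fin d))‖ ∧ _ ∧ _
  rw [hnorm]
  exact ⟨hr, trivial, rfl⟩
end

/-! ### Almost sure asymptotics of the radii and the limit shape -/

/-- In the coordinate `t = |x| ^ (-α)` the points of `s` on the ray of `u` become a set of positive
reals. -/
theorem rayPiece_inter_eq_image {E : Type*} [NormedAddCommGroup E] [NormedSpace ℝ E]
    {α : ℝ} (hα : 0 < α) {u : E} (hu : ‖u‖ = 1) (s : Set E) (T : Set ℝ) :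
    s ∩ rayPiece α u T =
      (fun t : ℝ => t ^ (-α)⁻¹ • u) '' ({t | 0 < t ∧ t ^ (-α)⁻¹ • u ∈ s} ∩ T) := by
  have hα' : -α ≠ 0 := by linarith
  ext x
  constructor
  · rintro ⟨hxs, hx0, hxT, hxu⟩
    have h1 : (‖x‖ ^ (-α)) ^ (-α)⁻¹ • u = x := by
      rw [Real.rpow_rpow_inv hx0.le hα', hxu]
    exact ⟨‖x‖ ^ (-α), ⟨⟨Real.rpow_pos_of_pos hx0 _, h1.symm ▸ hxs⟩, hxT⟩, h1⟩
  · rintro ⟨t, ⟨⟨ht0, hts⟩, htT⟩, rfl⟩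
    have hnorm : ‖t ^ (-α)⁻¹ • u‖ = t ^ (-α)⁻¹ := by
      rw [norm_smul, hu, mul_one, Real.norm_of_nonneg (Real.rpow_nonneg ht0.le _)]
    refine ⟨hts, ?_⟩
    change 0 < ‖t ^ (-α)⁻¹ • u‖ ∧ ‖t ^ (-α)⁻¹ • u‖ ^ (-α) ∈ T ∧ _ • u = t ^ (-α)⁻¹ • u
    rw [hnorm, Real.rpow_inv_rpow ht0.le hα']
    exact ⟨Real.rpow_pos_of_pos ht0 _, htT, rfl⟩

theorem injOn_rpow_smul {E : Type*} [NormedAddCommGroup E] [NormedSpace ℝ E]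
    {α : ℝ} (hα : 0 < α) {u : E} (hu : u ≠ 0) :
    Set.InjOn (fun t : ℝ => t ^ (-α)⁻¹ • u) (Set.Ioi 0) := by
  intro s hs t ht hst
  have hα' : -α ≠ 0 := by linarith
  have h1 : s ^ (-α)⁻¹ = t ^ (-α)⁻¹ := smul_left_injective ℝ hu hst
  rw [← Real.rpow_inv_rpow (le_of_lt hs) hα', h1, Real.rpow_inv_rpow (le_of_lt ht) hα']

/-- Almost surely the points of the process on the ray of an atom `u` of `ν` form a sequence whose radii
`r n` decrease and are asymptotic to `(ν {u} / n) ^ (1 / α)`. In the coordinate `|x| ^ (-α)` the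
process on this ray is homogeneous with rate `ν {u}`, so the law of large numbers applies to its
counts in unit intervals. -/
theorem IsPoissonPointProcess.ae_exists_radii {d : ℕ} {α : ℝ} (hα : 0 < α)
    {ν : Measure (Metric.sphere (0 : EuclideanSpace ℝ (Fin d)) 1)} [IsFiniteMeasure ν]
    {u : Metric.sphere (0 : EuclideanSpace ℝ (Fin d)) 1} (hu : 0 < ν {u})
    {Ω : Type*} [MeasurableSpace Ω] {P : Measure Ω} [IsProbabilityMeasure P]
    {ς : Ω → Set (EuclideanSpace ℝ (Fin d))}
    (hς : IsPoissonPointProcess P (controlMeasure α ν) ς) :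
    ∀ᵐ ω ∂P, ∃ r : ℕ → ℝ, (∀ n, 0 < r n) ∧ StrictAnti r ∧
      Tendsto (fun n : ℕ => ((n : ℝ) + 1) ^ (1 / α) * r n) atTop (𝓝 (ν.real {u} ^ (1 / α))) ∧
      ς ω ∩ rayPiece α (u : EuclideanSpace ℝ (Fin d)) Set.univ =
        Set.range fun n => r n • (u : EuclideanSpace ℝ (Fin d)) := by
  have hnorm : ‖(u : EuclideanSpace ℝ (Fin d))‖ = 1 := norm_eq_of_mem_sphere u
  have hu0 : (u : EuclideanSpace ℝ (Fin d)) ≠ 0 := by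
    rw [← norm_ne_zero_iff, hnorm]; exact one_ne_zero
  have hmeas0 := measurableSet_rayPiece α (u : EuclideanSpace ℝ (Fin d))
    (measurableSet_Iio (a := (1 : ℝ)))
  have hmeas := fun j : ℕ => measurableSet_rayPiece α (u : EuclideanSpace ℝ (Fin d))
    (measurableSet_Ico (a := (j : ℝ) + 1) (b := j + 2))
  have hμ0 : controlMeasure α ν (rayPiece α (u : EuclideanSpace ℝ (Fin d)) (Set.Iio 1)) ≠ ∞ := by
    rw [controlMeasure_rayPiece u measurableSet_Iio, radialMeasure_rpow_neg_Iio hα one_pos]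
    exact ENNReal.mul_ne_top ENNReal.ofReal_ne_top (measure_ne_top ν _)
  have hμ : ∀ j : ℕ, controlMeasure α ν (rayPiece α (u : EuclideanSpace ℝ (Fin d))
      (Set.Ico ((j : ℝ) + 1) (j + 2))) = ν {u} := by
    intro j
    rw [controlMeasure_rayPiece u measurableSet_Ico,
      radialMeasure_rpow_neg_Ico hα (by positivity) (by linarith),
      show (j : ℝ) + 2 - (j + 1) = 1 by ring, ENNReal.ofReal_one, one_mul]
  have hdisj : Pairwise fun i j : ℕ => Disjoint
      (rayPiece α (u : EuclideanSpace ℝ (Fin d)) (Set.Ico ((i : ℝ) + 1) (i + 2)))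
      (rayPiece α (u : EuclideanSpace ℝ (Fin d)) (Set.Ico ((j : ℝ) + 1) (j + 2))) := by
    intro i j hij
    rw [Set.disjoint_left]
    rintro x ⟨-, hi, -⟩ ⟨-, hj, -⟩
    have h1 : (i : ℝ) < j + 1 := by linarith [hi.1, hj.2]
    have h2 : (j : ℝ) < i + 1 := by linarith [hj.1, hi.2]
    have h3 : i < j + 1 := by exact_mod_cast h1
    have h4 : j < i + 1 := by exact_mod_cast h2
    omega
  filter_upwards [hς.ae_finite_inter hmeas0 hμ0,
    ae_all_iff.2 fun j => hς.ae_finite_inter (hmeas j) ((hμ j).trans_ne (measure_ne_top ν _)),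
    hς.ae_tendsto_average_ncard hmeas hdisj (measure_ne_top ν {u}) hμ] with ω h0 hj hlim
  set Q : Set ℝ := {t | 0 < t ∧ t ^ (-α)⁻¹ • (u : EuclideanSpace ℝ (Fin d)) ∈ ς ω} with hQ
  have hinj : ∀ T, Set.InjOn (fun t : ℝ => t ^ (-α)⁻¹ • (u : EuclideanSpace ℝ (Fin d))) (Q ∩ T) :=
    fun T => (injOn_rpow_smul hα hu0).mono fun t ht => ht.1.1
  have hfin : ∀ T, (ς ω ∩ rayPiece α (u : EuclideanSpace ℝ (Fin d)) T).Finite →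
      (Q ∩ T).Finite := fun T hT => by
    rw [rayPiece_inter_eq_image hα hnorm] at hT
    exact hT.of_finite_image (hinj T)
  have hcard : ∀ T, (ς ω ∩ rayPiece α (u : EuclideanSpace ℝ (Fin d)) T).ncard =
      (Q ∩ T).ncard := fun T => by
    rw [rayPiece_inter_eq_image hα hnorm, (hinj T).ncard_image]
  simp only [hcard] at hlim
  obtain ⟨q, hq, hrange, hqlim⟩ := exists_strictMono_range_eq_of_tendsto_shell_average
    (fun t ht => ht.1) (hfin _ h0) (fun j => hfin _ (hj j))
    (ENNReal.toReal_pos hu.ne' (measure_ne_top ν _)) hlim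
  have hq0 : ∀ n, 0 < q n := fun n => (hrange.subset ⟨n, rfl⟩).1
  refine ⟨fun n => q n ^ (-α)⁻¹, fun n => Real.rpow_pos_of_pos (hq0 n) _, fun m n hmn => ?_, ?_, ?_⟩
  · exact Real.rpow_lt_rpow_of_neg (hq0 m) (hq hmn) (by rw [inv_lt_zero]; linarith)
  · refine (hqlim.rpow_const (p := 1 / α) (Or.inr (by positivity))).congr fun n => ?_
    rw [Real.div_rpow (by positivity) (hq0 n).le, div_eq_mul_inv, ← Real.rpow_neg (hq0 n).le,
      one_div, ← inv_neg]
  · rw [rayPiece_inter_eq_image hα hnorm, Set.inter_univ, ← hQ, ← hrange, ← Set.range_comp]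
    rfl

theorem theorem2 {d l : ℕ} {α : ℝ} (hα : 0 < α)
    (ν : Measure (Metric.sphere (0 : EuclideanSpace ℝ (Fin d)) 1)) [IsFiniteMeasure ν]
    (e : Fin l → Metric.sphere (0 : EuclideanSpace ℝ (Fin d)) 1)
    (he : Function.Injective e)
    (hatom : ∀ i, 0 < ν {e i})
    (hsupp : ν (Set.range e)ᶜ = 0)
    (hcone : PointedCone.hull ℝ
      (Set.range fun i => (e i : EuclideanSpace ℝ (Fin d))) = ⊤)
    {Ω : Type*} [MeasurableSpace Ω] (P : Measure Ω) [IsProbabilityMeasure P]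
    (ς : Ω → Set (EuclideanSpace ℝ (Fin d)))
    (hς : IsPoissonPointProcess P (controlMeasure α ν) ς) :
    ∀ᵐ ω ∂P, Tendsto
      (fun k : ℕ => Metric.hausdorffEDist
        ((k : ℝ) ^ (1 / α) • peelHull (ς ω) k)
        (convexHull ℝ (Set.range fun i =>
          (ν.real {e i}) ^ (1 / α) • (e i : EuclideanSpace ℝ (Fin d)))))
      atTop (𝓝 0) := by
  have hcompl := hς.ae_inter_eq_empty (MeasurableSet.iUnion fun i => measurableSet_rayPiece _ _
    MeasurableSet.univ).compl (controlMeasure_compl_rays hsupp)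
  have hnorm : ∀ i, ‖(e i : EuclideanSpace ℝ (Fin d))‖ = 1 := fun i => norm_eq_of_mem_sphere _
  have hray : ∀ i j (s t : ℝ), 0 < s → 0 < t → s • (e i : EuclideanSpace ℝ (Fin d)) =
      t • (e j : EuclideanSpace ℝ (Fin d)) → i = j ∧ s = t := by
    intro i j s t hs ht hst
    have h1 := congrArg norm hst
    rw [norm_smul, norm_smul, hnorm, hnorm, mul_one, mul_one, Real.norm_of_nonneg hs.le,
      Real.norm_of_nonneg ht.le] at h1
    subst h1
    exact ⟨he (Subtype.coe_injective (smul_right_injective _ hs.ne' hst)), rfl⟩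
  filter_upwards [hcompl, ae_all_iff.2 fun i => hς.ae_exists_radii hα (hatom i)] with ω h0 hr
  choose r hr0 hranti hrlim hrange using hr
  have hset : ς ω = rayPoints (fun i => (e i : EuclideanSpace ℝ (Fin d))) r 0 := by
    ext x
    constructor
    · intro hx
      have h1 : x ∈ ⋃ i, rayPiece α (e i : EuclideanSpace ℝ (Fin d)) Set.univ := by
        by_contra hcon
        exact (h0.subset ⟨hx, hcon⟩).elim
      obtain ⟨i, hi⟩ := Set.mem_iUnion.1 h1
      obtain ⟨n, hn⟩ := (hrange i).subset ⟨hx, hi⟩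
      exact ⟨i, n, Nat.zero_le n, hn⟩
    · rintro ⟨i, n, -, rfl⟩
      exact ((hrange i).symm.subset ⟨n, rfl⟩).1
  rw [hset]
  rcases isEmpty_or_nonempty (Fin l) with hl | hl
  · -- without rays (only possible for `d = 0`) both sets are empty
    have hempty : ∀ k, peelPoints
        (rayPoints (fun i => (e i : EuclideanSpace ℝ (Fin d))) r 0) k = ∅ := by
      intro k
      induction k with
      | zero =>
        refine Set.eq_empty_of_forall_notMem ?_
        rintro x ⟨i, -⟩
        exact hl.elim i
      | succ k ih => rw [peelPoints, ih, Set.empty_sdiff]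
    refine tendsto_const_nhds.congr fun k => ?_
    rw [peelHull, hempty, convexHull_empty, Set.smul_set_empty, Set.range_eq_empty,
      convexHull_empty, Metric.hausdorffEDist_self]
  · exact tendsto_hausdorffEDist_peelHull_rayPoints
      (fun i => norm_ne_zero_iff.1 (by rw [hnorm]; exact one_ne_zero)) hray hcone hα
      (fun i => Real.rpow_pos_of_pos (ENNReal.toReal_pos (hatom i).ne' (measure_ne_top ν _)) _)
      hr0 hranti hrlim
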